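/- Consider the adaptive robust binary optimization problem $$\min_{x\in X}\ \max_{\xi\in\Xi}\ \min_{y\in Y\cap S(x)}\ c^\top x+\xi^\top y, \qquad (1)$$ where $X\subseteq\{0,1\}^m$, $\Xi=\{\xi\in\mathbb R^n : T\xi\le d\}$ is a non-empty bounded polyhedron, $Y=\{y\in\{0,1\}^n : Gy\ge h\}$, and $$S(x)=\{y\in\mathbb R^n : y_i\le x_j\ \forall (i,j)\in U_1,\ y_i=x_j\ \forall (i,j)\in U_2,\ y_i\ge x_j\ \forall (i,j)\in U_3\}$$ with $U_1,U_2,U_3\subseteq\{1,\dots,n\}\times\{1,\dots,m\}$ (selective adaptability). A minimum over the empty set is $+\infty$. Let $D$ be an exact binary decision diagram for $Y$, that is, a finite directed graph with node set $\mathcal V$ and arc set $\mathcal A$ (parallel arcs allowed) whose nodes are partitioned into non-empty layers $\mathcal V_1=\{r\},\mathcal V_2,\dots,\mathcal V_{n+1}=\{t\}$, in which every arc goes from some $\mathcal V_i$ to $\mathcal V_{i+1}$ and has a label in $\{0,1\}$, and such that the label sequences of the paths from $r$ to $t$ are exactly the elements of $Y$. Let $\mathcal A_i^1$ be the set of arcs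 with label $1$ leaving $\mathcal V_i$, let $A$ be the node–arc incidence matrix of $D$ ($-1$ at the tail and $+1$ at the head of each arc), and let $b\in\mathbb R^{\mathcal V}$ have entry $-1$ at $r$, $+1$ at $t$ and $0$ elsewhere ($b=0$ if $n=0$, when $r=t$). Then (1) is equivalent to the constrained network flow problem $$\begin{aligned}\min_{x,y,z,\lambda}\quad & c^\top x+d^\top\lambda\\ \text{s.t.}\quad & T^\top\lambda=y,\\ & y_i=\sum_{j\in\mathcal A_i^1}z_j\quad (i=1,\dots,n),\\ & Az=b,\\ & y\in S(x),\quad x\in X,\quad z\ge 0,\quad \lambda\ge 0, \end{aligned}\qquad (2)$$ which is a mixed-integer linear program with integer variables $x$ and continuous variables $y,z,\lambda$ (its feasible set is given by finitely many linear inequalities and the integrality of $x$). Equivalence means: (1) and (2) have the same optimal value in $[-\infty,+\infty]$; for every fixed $x\in X$, the value $\max_{\xi\in\Xi}\min_{y\in Y\cap S(x)}c^\top x+\xi^\top y$ equals the infimum of the objective of (2) over its feasible points with that $x$; and a vector $x$ is an optimal first-stage decision of (1), i.e. $x\in X$, $Y\cap S(x)\neq\emptyset$ and $x$ minimizes the worst-case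 cost over $X$, if and only if $x$ is the first component of an optimal solution $(x,y,z,\lambda)$ of (2). -/

import Mathlib

open scoped Matrix

noncomputable section

/-- The 0-1 vectors of `ℝⁿ`. -/
def binaryVectors (n : ℕ) : Set (Fin n → ℝ) :=
  {y | ∀ i, y i = 0 ∨ y i = 1}

/-- The data of an adaptive robust binary optimization problem
`min_{x ∈ X} max_{ξ ∈ Ξ} min_{y ∈ Y ∩ S(x)} cᵀ x + ξᵀ y` with selectively adaptive linking
constraints, where `Ξ = {ξ | T ξ ≤ d}`, `Y = {y ∈ {0,1}ⁿ | G y ≥ h}`, and `S(x)` is given by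
constraints `y i ≤ x j`, `y i = x j`, `y i ≥ x j` for `(i, j)` in `U₁`, `U₂`, `U₃`. -/
structure ARBO (m n p k : ℕ) where
  c : Fin m → ℝ
  X : Set (Fin m → ℝ)
  T : Matrix (Fin p) (Fin n) ℝ
  d : Fin p → ℝ
  G : Matrix (Fin k) (Fin n) ℝ
  h : Fin k → ℝ
  U₁ : Set (Fin n × Fin m)
  U₂ : Set (Fin n × Fin m)
  U₃ : Set (Fin n × Fin m)

namespace ARBO

variable {m n p k : ℕ} (P : ARBO m n p k)

/-- The uncertainty set `Ξ`. -/
def uncertaintySet : Set (Fin n → ℝ) :=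
  {ξ | P.T *ᵥ ξ ≤ P.d}

/-- The recourse set `Y`. -/
def recourseSet : Set (Fin n → ℝ) :=
  {y | y ∈ binaryVectors n ∧ P.h ≤ P.G *ᵥ y}

/-- The selectively adaptive linking set `S(x)`, a subset of `ℝⁿ`. -/
def linkingSet (x : Fin m → ℝ) : Set (Fin n → ℝ) :=
  {y | (∀ q ∈ P.U₁, y q.1 ≤ x q.2) ∧ (∀ q ∈ P.U₂, y q.1 = x q.2) ∧
    (∀ q ∈ P.U₃, x q.2 ≤ y q.1)}

/-- The worst-case cost `max_{ξ ∈ Ξ} min_{y ∈ Y ∩ S(x)} cᵀ x + ξᵀ y` of a first-stage decision,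
in the extended reals: it is `⊤` when `x` admits no recourse decision (and `Ξ` is non-empty). -/
def worstCaseCost (x : Fin m → ℝ) : EReal :=
  ⨆ ξ ∈ P.uncertaintySet, ⨅ y ∈ P.recourseSet ∩ P.linkingSet x,
    ((P.c ⬝ᵥ x + ξ ⬝ᵥ y : ℝ) : EReal)

/-- The optimal value of the min-max-min problem. -/
def optimalValue : EReal :=
  ⨅ x ∈ P.X, P.worstCaseCost x

/-- `x` is an optimal first-stage decision: it is in `X`, it admits a recourse decision, and it
minimizes the worst-case cost over `X`. -/
def IsOptimalFirstStage (x : Fin m → ℝ) : Prop :=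
  x ∈ P.X ∧ (P.recourseSet ∩ P.linkingSet x).Nonempty ∧
    ∀ x' ∈ P.X, P.worstCaseCost x ≤ P.worstCaseCost x'

end ARBO

/-- A binary decision diagram with node set `V` and arc set `Arc` (parallel arcs are allowed).
The nodes are partitioned into `n + 1` non-empty layers, indexed here by `0, …, n`; the first
layer consists of the root only and the last one of the terminal only; every arc goes from a layer
to the next one and is labelled 0 (`false`) or 1 (`true`). -/
structure BDD (n : ℕ) (V Arc : Type*) where
  layer : V → Fin (n + 1)
  layer_nonempty : ∀ i, ∃ v, layer v = i
  root : V
  terminal : V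
  layer_eq_zero_iff : ∀ v, layer v = 0 ↔ v = root
  layer_eq_last_iff : ∀ v, layer v = Fin.last n ↔ v = terminal
  src : Arc → V
  dst : Arc → V
  label : Arc → Bool
  layer_dst : ∀ a, (layer (dst a) : ℕ) = (layer (src a) : ℕ) + 1

namespace BDD

variable {n : ℕ} {V Arc : Type*} (D : BDD n V Arc)

/-- The arcs `a 0, …, a (n - 1)` form a directed path from the root to the terminal. (By the
layering, every such path has exactly `n` arcs.) -/
def IsRootTerminalPath (a : Fin n → Arc) : Prop :=
  ∃ u : Fin (n + 1) → V, u 0 = D.root ∧ u (Fin.last n) = D.terminal ∧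
    ∀ i : Fin n, D.src (a i) = u i.castSucc ∧ D.dst (a i) = u i.succ

/-- The 0-1 vector spelled by the labels of a sequence of arcs. -/
def pathVector (a : Fin n → Arc) : Fin n → ℝ :=
  fun i => if D.label (a i) then 1 else 0

/-- `D` is an exact diagram of `Y`: the root-terminal paths spell exactly the elements of `Y`. -/
def IsExactFor (Y : Set (Fin n → ℝ)) : Prop :=
  Y = {y | ∃ a, D.IsRootTerminalPath a ∧ D.pathVector a = y}

/-- The 1-arcs that leave the nodes of layer `i`. -/
def oneArcs [Fintype Arc] (i : Fin n) : Finset Arc :=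
  Finset.univ.filter fun a => D.layer (D.src a) = i.castSucc ∧ D.label a = true

/-- The node-arc incidence matrix: `-1` at the tail and `1` at the head of each arc. -/
def incidence [DecidableEq V] : Matrix V Arc ℝ :=
  Matrix.of fun v a => (if D.dst a = v then 1 else 0) - (if D.src a = v then 1 else 0)

/-- The right-hand side of flow conservation for one unit from root to terminal: `-1` at the
root, `1` at the terminal, `0` elsewhere. (For `n = 0` root and terminal coincide, and it is `0`.) -/
def supply [DecidableEq V] : V → ℝ :=
  fun v => (if v = D.terminal then 1 else 0) - (if v = D.root then 1 else 0)

end BDD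

namespace ARBO

variable {m n p k : ℕ} {V Arc : Type*} [DecidableEq V] [Fintype Arc]

/-- The feasible points `(x, y, z, λ)` of the constrained network flow model. -/
def flowFeasible (P : ARBO m n p k) (D : BDD n V Arc) :
    Set ((Fin m → ℝ) × (Fin n → ℝ) × (Arc → ℝ) × (Fin p → ℝ)) :=
  {(x, y, z, lam) | P.Tᵀ *ᵥ lam = y ∧ (∀ i, y i = ∑ a ∈ D.oneArcs i, z a) ∧
    D.incidence *ᵥ z = D.supply ∧ y ∈ P.linkingSet x ∧ x ∈ P.X ∧ 0 ≤ z ∧ 0 ≤ lam}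

/-- The objective `cᵀ x + dᵀ λ` of the constrained network flow model. -/
def flowObjective (P : ARBO m n p k) :
    (Fin m → ℝ) × (Fin n → ℝ) × (Arc → ℝ) × (Fin p → ℝ) → ℝ :=
  fun (x, _, _, lam) => P.c ⬝ᵥ x + P.d ⬝ᵥ lam

end ARBO

/-- The set `F` of pairs `(x, w)` is the feasible set of a mixed-integer linear program with integer
variables `x` and continuous variables `w`: it is cut out by finitely many linear inequalities and
the integrality of `x`. -/
def IsMILPFeasibleSet {m : ℕ} {E : Type*} [AddCommGroup E] [Module ℝ E]
    (F : Set ((Fin m → ℝ) × E)) : Prop :=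
  ∃ C : Finset ((((Fin m → ℝ) × E) →ₗ[ℝ] ℝ) × ℝ),
    F = {w : (Fin m → ℝ) × E | (∀ j, ∃ q : ℤ, w.1 j = (q : ℝ)) ∧ ∀ r ∈ C, r.1 w ≤ r.2}

end

/-! Fix `x`. The flow model replaces the inner minimum over recourse decisions by one over their
convex combinations, and the maximum over `ξ` by its linear programming dual.

Flow to recourse: the support of a unit flow contains a root-terminal path that costs no more than
the flow, for any arc costs (`exists_path_cost_le`). Such a path respects the linking constraints
because `x` is binary: `0 < y i` on its 1-arcs and `y i < 1` on its 0-arcs, so the bounds on the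
fractional `y i` pass to its labels (`pathVector_mem_linkingSet`). Weak duality then bounds the
worst-case cost by the flow objective.

Recourse to flow: if every `ξ` leaves some recourse decision of cost at most `v`, Farkas' lemma
gives one convex combination with a dual certificate (`exists_dual_certificate`). The same
combination of path flows is feasible, since `S(x)` is convex, so the infimum for this `x` is
attained whenever recourse exists. -/

/-! ### Farkas' lemma and linear programming duality. -/

/-- **Farkas' lemma** for finitely many linear functionals. -/
theorem exists_nonneg_sum_smul_eq_of_nonpos {K W ι : Type*} [Field K] [LinearOrder K]
    [IsStrictOrderedRing K] [AddCommGroup W] [Module K W] (s : Finset ι)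
    (l : ι → W →ₗ[K] K) (f : W →ₗ[K] K)
    (h : ∀ x, (∀ i ∈ s, l i x ≤ 0) → f x ≤ 0) :
    ∃ μ : ι → K, (∀ i, 0 ≤ μ i) ∧ f = ∑ i ∈ s, μ i • l i := by
  classical
  induction s using Finset.induction_on generalizing l f with
  | empty =>
    refine ⟨0, fun _ => le_rfl, ?_⟩
    ext x
    have h₁ := h x (by simp)
    have h₂ := h (-x) (by simp)
    rw [map_neg] at h₂
    simp only [Finset.sum_empty, LinearMap.zero_apply]
    linarith
  | insert j s hj ih =>
    by_cases hs : ∀ x, (∀ i ∈ s, l i x ≤ 0) → f x ≤ 0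
    · obtain ⟨μ, hμ, rfl⟩ := ih l f hs
      refine ⟨Function.update μ j 0, fun i => ?_, ?_⟩
      · by_cases hi : i = j
        · simp [hi]
        · simp [hi, hμ i]
      · rw [Finset.sum_insert hj]
        simp only [Function.update_self, zero_smul, zero_add]
        refine Finset.sum_congr rfl fun i hi => ?_
        rw [Function.update_of_ne (ne_of_mem_of_not_mem hi hj)]
    · push Not at hs
      obtain ⟨x₁, hx₁, hf₁⟩ := hs
      have hl₁ : 0 < l j x₁ := by
        by_contra! hl
        refine absurd (h x₁ fun i hi => ?_) (not_le.2 hf₁)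
        rcases Finset.mem_insert.1 hi with rfl | hi
        · exact hl
        · exact hx₁ i hi
      -- A point violating the conclusion for `s` must violate the constraint `l j`; it is
      -- normalized so that `l j x₀ = 1`.
      obtain ⟨x₀, hx₀, hf₀, hl₀⟩ :
          ∃ x₀, (∀ i ∈ s, l i x₀ ≤ 0) ∧ 0 < f x₀ ∧ l j x₀ = 1 := by
        refine ⟨(l j x₁)⁻¹ • x₁, fun i hi => ?_, ?_, ?_⟩
        · rw [map_smul, smul_eq_mul]
          exact mul_nonpos_of_nonneg_of_nonpos (inv_nonneg.2 hl₁.le) (hx₁ i hi)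
        · rw [map_smul, smul_eq_mul]
          exact mul_pos (inv_pos.2 hl₁) hf₁
        · rw [map_smul, smul_eq_mul, inv_mul_cancel₀ hl₁.ne']
      -- Induction on the functionals composed with the projection `x ↦ x - l j x • x₀` onto the
      -- kernel of `l j`.
      obtain ⟨μ, hμ, hfμ⟩ := ih (fun i => l i - l i x₀ • l j) (f - f x₀ • l j) (by
        intro x hx
        have key := h (x - l j x • x₀) (by
          intro i hi
          rcases Finset.mem_insert.1 hi with rfl | hi
          · simp [hl₀]
          · have := hx i hi
            simp only [LinearMap.sub_apply, LinearMap.smul_apply, smul_eq_mul] at this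
            simp only [map_sub, map_smul, smul_eq_mul]
            linarith [mul_comm (l i x₀) (l j x)])
        simp only [map_sub, map_smul, smul_eq_mul] at key
        simp only [LinearMap.sub_apply, LinearMap.smul_apply, smul_eq_mul]
        linarith [mul_comm (f x₀) (l j x)])
      have hneg : ∑ i ∈ s, μ i * l i x₀ ≤ 0 :=
        Finset.sum_nonpos fun i hi => mul_nonpos_of_nonneg_of_nonpos (hμ i) (hx₀ i hi)
      refine ⟨Function.update μ j (f x₀ - ∑ i ∈ s, μ i * l i x₀), fun i => ?_, ?_⟩
      · by_cases hi : i = j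
        · subst hi
          rw [Function.update_self]
          linarith
        · simp [hi, hμ i]
      · rw [Finset.sum_insert hj, Function.update_self]
        have hsum : ∑ i ∈ s, Function.update μ j (f x₀ - ∑ i ∈ s, μ i * l i x₀) i • l i =
            ∑ i ∈ s, μ i • l i := by
          refine Finset.sum_congr rfl fun i hi => ?_
          rw [Function.update_of_ne (ne_of_mem_of_not_mem hi hj)]
        rw [hsum]
        ext x
        have := congrArg (fun g : W →ₗ[K] K => g x) hfμ
        simp only [LinearMap.sub_apply, LinearMap.smul_apply, smul_eq_mul, LinearMap.sum_apply,
          mul_sub, Finset.sum_sub_distrib] at this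
        simp only [LinearMap.add_apply, LinearMap.smul_apply, smul_eq_mul, LinearMap.sum_apply,
          sub_mul, Finset.sum_mul]
        simp only [← mul_assoc] at this
        linarith

/-- Strong duality for maximizing over a polyhedron a minimum of finitely many linear functions:
if `min_{y ∈ S} ξᵀ y ≤ v` whenever `T ξ ≤ d`, then some convex combination of `S` has a dual
certificate `λ` of value at most `v`. -/
theorem exists_dual_certificate {n p : ℕ} (T : Matrix (Fin p) (Fin n) ℝ) (d : Fin p → ℝ)
    (hΞ : ∃ ξ, T *ᵥ ξ ≤ d) (S : Finset (Fin n → ℝ)) (hS : S.Nonempty) (v : ℝ)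
    (h : ∀ ξ, T *ᵥ ξ ≤ d → ∃ y ∈ S, ξ ⬝ᵥ y ≤ v) :
    ∃ (lam : Fin p → ℝ) (μ : (Fin n → ℝ) → ℝ), 0 ≤ lam ∧ (∀ y, 0 ≤ μ y) ∧
      ∑ y ∈ S, μ y = 1 ∧ Tᵀ *ᵥ lam = ∑ y ∈ S, μ y • y ∧ d ⬝ᵥ lam ≤ v := by
  classical
  -- Homogenization in variables `(ξ, θ, τ)`: the constraints `0 ≤ τ`, `T ξ ≤ τ d` and `θ ≤ ξᵀ y`
  -- for `y ∈ S` imply `θ ≤ v τ`.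
  let pξ : (Fin n → ℝ) × ℝ × ℝ →ₗ[ℝ] (Fin n → ℝ) := LinearMap.fst ℝ _ _
  let pθ : (Fin n → ℝ) × ℝ × ℝ →ₗ[ℝ] ℝ := LinearMap.fst ℝ _ _ ∘ₗ LinearMap.snd ℝ _ _
  let pτ : (Fin n → ℝ) × ℝ × ℝ →ₗ[ℝ] ℝ := LinearMap.snd ℝ _ _ ∘ₗ LinearMap.snd ℝ _ _
  let l : Option (Fin p ⊕ (Fin n → ℝ)) → (Fin n → ℝ) × ℝ × ℝ →ₗ[ℝ] ℝ
    | none => -pτ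
    | some (Sum.inl i) => LinearMap.proj i ∘ₗ Matrix.mulVecLin T ∘ₗ pξ - d i • pτ
    | some (Sum.inr y) => pθ - (dotProductBilin ℝ ℝ).flip y ∘ₗ pξ
  obtain ⟨μ, hμ, hf⟩ := exists_nonneg_sum_smul_eq_of_nonpos
    (Finset.insertNone (Finset.univ.disjSum S)) l (pθ - v • pτ) (by
      rintro ⟨ξ, θ, τ⟩ hx
      have hτ : 0 ≤ τ := by simpa [l, pτ] using hx none (by simp)
      have hT : T *ᵥ ξ ≤ τ • d := fun i => by
        have := hx (some (Sum.inl i)) (by simp)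
        simp only [l, pξ, pτ] at this
        simp at this
        simpa [mul_comm] using this
      have hθ : ∀ y ∈ S, θ ≤ ξ ⬝ᵥ y := fun y hy => by
        have := hx (some (Sum.inr y)) (by simpa using hy)
        simp only [l, pξ, pθ] at this
        simpa using this
      suffices θ ≤ v * τ by simpa [pθ, pτ] using this
      rcases hτ.eq_or_lt with rfl | hτ
      -- For `τ = 0`, `ξ` is a recession direction. If `θ > 0`, the step length `(|v - q| + 1) / θ`
      -- from `ξ₀` raises each `ξ₀ᵀ y ≥ q` by at least `|v - q| + 1`, hence above `v`.
      · obtain ⟨ξ₀, hξ₀⟩ := hΞ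
        obtain ⟨y₀, -, hy₀⟩ := S.exists_min_image (fun y => ξ₀ ⬝ᵥ y) hS
        rw [mul_zero]
        by_contra! hpos
        set q := ξ₀ ⬝ᵥ y₀
        obtain ⟨y, hy, hle⟩ := h (ξ₀ + ((|v - q| + 1) / θ) • ξ) (by
          rw [Matrix.mulVec_add, Matrix.mulVec_smul]
          intro i
          have h₁ := hξ₀ i
          have h₂ := hT i
          have h₃ : 0 ≤ (|v - q| + 1) / θ := by positivity
          simp only [zero_smul, Pi.zero_apply] at h₂
          have := mul_nonpos_of_nonneg_of_nonpos h₃ h₂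
          simp only [Pi.add_apply, Pi.smul_apply, smul_eq_mul]
          linarith)
        rw [add_dotProduct, smul_dotProduct, smul_eq_mul] at hle
        have h₁ := hy₀ y hy
        have h₂ : |v - q| + 1 ≤ (|v - q| + 1) / θ * (ξ ⬝ᵥ y) := by
          calc |v - q| + 1 = (|v - q| + 1) / θ * θ := by field_simp
            _ ≤ _ := by gcongr; exact hθ y hy
        have := le_abs_self (v - q)
        linarith
      · obtain ⟨y, hy, hle⟩ := h (τ⁻¹ • ξ) (by
          rw [Matrix.mulVec_smul]
          intro i
          have := hT i
          simp only [Pi.smul_apply, smul_eq_mul] at this ⊢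
          rw [inv_mul_le_iff₀ hτ]
          exact this)
        rw [smul_dotProduct, smul_eq_mul, inv_mul_le_iff₀ hτ] at hle
        linarith [hθ y hy, mul_comm v τ])
  -- The coefficients of `θ`, `ξ` and `τ` in this identity give the three conclusions; the
  -- multiplier of `0 ≤ τ` is the slack in `dᵀ λ ≤ v`.
  have hf' : ∀ ξ θ τ, θ - v * τ = μ none * -τ +
      (∑ i, μ (some (Sum.inl i)) * ((T *ᵥ ξ) i - d i * τ) +
        ∑ y ∈ S, μ (some (Sum.inr y)) * (θ - ξ ⬝ᵥ y)) := fun ξ θ τ => by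
    have := congrArg (fun g : (Fin n → ℝ) × ℝ × ℝ →ₗ[ℝ] ℝ => g (ξ, θ, τ)) hf
    rw [Finset.sum_insertNone, Finset.sum_disjSum] at this
    simp only [l, pξ, pθ, pτ] at this
    simpa using this
  refine ⟨fun i => μ (some (Sum.inl i)), fun y => μ (some (Sum.inr y)), fun i => hμ _,
    fun y => hμ _, ?_, ?_, ?_⟩
  · simpa using (hf' 0 1 0).symm
  · ext j
    have := hf' (Pi.single j 1) 0 0
    simp at this
    simp [Matrix.mulVec, dotProduct, Finset.sum_apply]
    simp only [mul_comm (T _ _)]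
    linarith
  · have h₁ := hf' 0 0 1
    have h₂ := hμ none
    simp at h₁
    simp only [dotProduct]
    simp only [mul_comm (d _)]
    linarith

/-! ### Unit flows and paths in a layered diagram. -/

namespace BDD

variable {n : ℕ} {V Arc : Type*} (D : BDD n V Arc)

theorem layer_root : D.layer D.root = 0 := (D.layer_eq_zero_iff _).2 rfl

theorem layer_terminal : D.layer D.terminal = Fin.last n := (D.layer_eq_last_iff _).2 rfl

theorem layer_src_lt (a : Arc) : (D.layer (D.src a) : ℕ) < n := by
  have h₁ := D.layer_dst a
  have h₂ := (D.layer (D.dst a)).isLt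
  omega

variable {D} in
/-- Along a root-terminal path, the `i`-th arc leaves layer `i`. -/
theorem IsRootTerminalPath.layer_src {a : Fin n → Arc} (ha : D.IsRootTerminalPath a) (i : Fin n) :
    D.layer (D.src (a i)) = i.castSucc := by
  obtain ⟨u, h0, -, hu⟩ := ha
  suffices ∀ i : Fin (n + 1), D.layer (u i) = i by rw [(hu i).1, this]
  intro i
  induction i using Fin.induction with
  | zero => rw [h0, layer_root]
  | succ i ih =>
    have := D.layer_dst (a i)
    rw [(hu i).1, (hu i).2, ih] at this
    exact Fin.ext (by simpa using this)

open Classical in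
/-- The unit flow along a sequence of arcs. -/
noncomputable def pathFlow (a : Fin n → Arc) : Arc → ℝ :=
  ∑ i, Pi.single (a i) 1

theorem pathFlow_nonneg (a : Fin n → Arc) : 0 ≤ pathFlow a :=
  Finset.sum_nonneg fun i _ => by
    classical
    exact Pi.single_nonneg.2 zero_le_one

section Flow

variable [Fintype Arc]

theorem incidence_mulVec_apply [DecidableEq V] (z : Arc → ℝ) (v : V) :
    (D.incidence *ᵥ z) v =
      ∑ a, (if D.dst a = v then z a else 0) - ∑ a, (if D.src a = v then z a else 0) := by
  simp [incidence, Matrix.mulVec, dotProduct, sub_mul, Finset.sum_sub_distrib]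

/-- The total potential difference along a unit flow is the one between terminal and root. -/
theorem sum_mul_potential_sub [Fintype V] [DecidableEq V] {z : Arc → ℝ}
    (hz : D.incidence *ᵥ z = D.supply) (g : V → ℝ) :
    ∑ a, z a * (g (D.dst a) - g (D.src a)) = g D.terminal - g D.root := by
  have h : g ⬝ᵥ D.incidence *ᵥ z = g ⬝ᵥ D.supply := by rw [hz]
  rw [Matrix.dotProduct_mulVec] at h
  simp only [dotProduct, Matrix.vecMul, incidence, supply, Matrix.of_apply, mul_sub,
    Finset.sum_sub_distrib, mul_ite, mul_one, mul_zero, Finset.sum_ite_eq, Finset.sum_ite_eq',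
    Finset.mem_univ, if_true] at h
  rw [← h]
  exact Finset.sum_congr rfl fun a _ => mul_comm _ _

/-- A unit flow sends one unit through every layer. -/
theorem sum_layer_eq_one [Fintype V] [DecidableEq V] {z : Arc → ℝ}
    (hz : D.incidence *ᵥ z = D.supply) (i : Fin n) :
    ∑ a, (if D.layer (D.src a) = i.castSucc then z a else 0) = 1 := by
  -- The potential is the indicator of the nodes beyond layer `i`; only arcs leaving layer `i`
  -- change it.
  have h := D.sum_mul_potential_sub hz fun v => if (i : ℕ) < D.layer v then 1 else 0
  rw [layer_root, layer_terminal] at h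
  simp only [Fin.val_last, i.isLt, if_true, Fin.val_zero, not_lt_zero, if_false, sub_zero] at h
  rw [← h]
  refine Finset.sum_congr rfl fun a _ => ?_
  have h₁ := D.layer_dst a
  rw [h₁]
  simp only [Fin.ext_iff, Fin.val_castSucc]
  split_ifs <;> first | omega | simp

/-- In the support of a unit flow, a node other than the root that is the terminal or the tail of
an arc is also the head of an arc. -/
theorem exists_incoming [DecidableEq V] {z : Arc → ℝ} (h0 : 0 ≤ z)
    (hz : D.incidence *ᵥ z = D.supply) {v : V} (hr : v ≠ D.root)
    (hv : v = D.terminal ∨ ∃ a, 0 < z a ∧ D.src a = v) : ∃ a, 0 < z a ∧ D.dst a = v := by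
  by_contra! hin
  have h := congrFun hz v
  rw [incidence_mulVec_apply, Finset.sum_eq_zero fun a _ => ?_] at h
  · have hnn : ∀ a ∈ Finset.univ, 0 ≤ if D.src a = v then z a else 0 := fun a _ => by
      split_ifs
      exacts [h0 a, le_rfl]
    simp only [supply, hr, if_false, sub_zero, zero_sub] at h
    rcases hv with hv | ⟨a, ha, hav⟩
    · have := Finset.sum_nonneg hnn
      rw [if_pos hv] at h
      linarith
    · have := Finset.single_le_sum hnn (Finset.mem_univ a)
      rw [if_pos hav] at this
      split_ifs at h <;> linarith
  · split_ifs with hav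
    · exact le_antisymm (not_lt.1 fun ha => hin a ha hav) (h0 a)
    · rfl

open Classical in
/-- The least cost of a path with `ℓ` arcs in the support of `z` that ends in a given node. -/
noncomputable def minCost (z w : Arc → ℝ) : ℕ → V → ℝ
  | 0, _ => 0
  | ℓ + 1, v =>
    if h : (Finset.univ.filter fun a => 0 < z a ∧ D.dst a = v).Nonempty then
      (Finset.univ.filter fun a => 0 < z a ∧ D.dst a = v).inf' h
        fun a => minCost z w ℓ (D.src a) + w a
    -- A harmless default: in the support of a unit flow, every tail other than the root has an
    -- incoming arc.
    else 0

theorem minCost_dst_le {z w : Arc → ℝ} (ℓ : ℕ) {a : Arc} (ha : 0 < z a) :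
    D.minCost z w (ℓ + 1) (D.dst a) ≤ D.minCost z w ℓ (D.src a) + w a := by
  classical
  have hmem : a ∈ Finset.univ.filter fun b => 0 < z b ∧ D.dst b = D.dst a := by simp [ha]
  rw [minCost, dif_pos ⟨a, hmem⟩]
  exact Finset.inf'_le _ hmem

theorem exists_minCost_eq {z w : Arc → ℝ} (ℓ : ℕ) {v : V} (hv : ∃ a, 0 < z a ∧ D.dst a = v) :
    ∃ a, 0 < z a ∧ D.dst a = v ∧
      D.minCost z w (ℓ + 1) v = D.minCost z w ℓ (D.src a) + w a := by
  classical
  have hne : (Finset.univ.filter fun a => 0 < z a ∧ D.dst a = v).Nonempty := by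
    obtain ⟨a, ha⟩ := hv
    exact ⟨a, by simpa using ha⟩
  obtain ⟨a, ha, he⟩ := Finset.exists_mem_eq_inf' hne fun a => D.minCost z w ℓ (D.src a) + w a
  rw [Finset.mem_filter] at ha
  refine ⟨a, ha.2.1, ha.2.2, ?_⟩
  rw [minCost, dif_pos hne, he]

/-- Backtracking along arcs that attain the minimum: by `exists_incoming` this never stops before
layer 0, which contains only the root. -/
theorem exists_path_minCost [DecidableEq V] {z : Arc → ℝ} (h0 : 0 ≤ z)
    (hz : D.incidence *ᵥ z = D.supply) (w : Arc → ℝ) (ℓ : ℕ) (v : V) (hℓ : (D.layer v : ℕ) = ℓ)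
    (hv : v = D.root ∨ ∃ a, 0 < z a ∧ D.dst a = v) :
    ∃ (a : Fin ℓ → Arc) (u : Fin (ℓ + 1) → V), u 0 = D.root ∧ u (Fin.last ℓ) = v ∧
      (∀ i : Fin ℓ, D.src (a i) = u i.castSucc ∧ D.dst (a i) = u i.succ) ∧
      (∀ i, 0 < z (a i)) ∧ ∑ i, w (a i) = D.minCost z w ℓ v := by
  induction ℓ generalizing v with
  | zero =>
    have hr : v = D.root := (D.layer_eq_zero_iff v).1 (Fin.ext (by simpa using hℓ))
    exact ⟨Fin.elim0, fun _ => v, hr, rfl, fun i => i.elim0, fun i => i.elim0, by simp [minCost]⟩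
  | succ ℓ ih =>
    have hr : v ≠ D.root := fun h => by
      rw [h, layer_root] at hℓ
      simp at hℓ
    obtain ⟨e, he, rfl, hcost⟩ := D.exists_minCost_eq (w := w) ℓ (hv.resolve_left hr)
    have hs : D.src e = D.root ∨ ∃ a, 0 < z a ∧ D.dst a = D.src e :=
      or_iff_not_imp_left.2 fun h => D.exists_incoming h0 hz h (Or.inr ⟨e, he, rfl⟩)
    obtain ⟨a, u, hu0, hul, hau, hpos, hsum⟩ := ih (D.src e)
      (by have := D.layer_dst e; omega) hs
    refine ⟨Fin.snoc a e, Fin.snoc u (D.dst e), ?_, by simp, fun i => ?_, fun i => ?_, ?_⟩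
    · rw [← Fin.castSucc_zero, Fin.snoc_castSucc (α := fun _ => V), hu0]
    · induction i using Fin.lastCases with
      | last => simp [hul]
      | cast i =>
        rw [Fin.snoc_castSucc (α := fun _ => Arc), Fin.snoc_castSucc (α := fun _ => V),
          Fin.succ_castSucc, Fin.snoc_castSucc (α := fun _ => V)]
        exact hau i
    · induction i using Fin.lastCases with
      | last => simpa using he
      | cast i => simpa using hpos i
    · rw [Fin.sum_univ_castSucc, hcost, ← hsum]
      simp

/-- The support of a unit flow contains a root-terminal path that costs at most as much as the
flow. -/
theorem exists_path_cost_le [Fintype V] [DecidableEq V] {z : Arc → ℝ} (h0 : 0 ≤ z)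
    (hz : D.incidence *ᵥ z = D.supply) (w : Arc → ℝ) :
    ∃ a, D.IsRootTerminalPath a ∧ (∀ i, 0 < z (a i)) ∧ ∑ i, w (a i) ≤ ∑ e, z e * w e := by
  have ht : D.terminal = D.root ∨ ∃ a, 0 < z a ∧ D.dst a = D.terminal :=
    or_iff_not_imp_left.2 fun h => D.exists_incoming h0 hz h (Or.inl rfl)
  obtain ⟨a, u, hu0, hul, hau, hpos, hsum⟩ :=
    D.exists_path_minCost h0 hz w n D.terminal (by simp [layer_terminal]) ht
  refine ⟨a, ⟨u, hu0, hul, hau⟩, hpos, ?_⟩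
  -- With least costs as potential, the potential difference is at most `w` on each support arc,
  -- while the flow-weighted differences sum to the least cost at the terminal.
  have h := D.sum_mul_potential_sub hz fun v => D.minCost z w (D.layer v) v
  simp only [layer_root, layer_terminal, Fin.val_last, Fin.val_zero] at h
  rw [hsum]
  have hr : D.minCost z w 0 D.root = 0 := rfl
  rw [hr, sub_zero] at h
  rw [← h]
  refine Finset.sum_le_sum fun e _ => ?_
  rcases (h0 e).eq_or_lt with he | he
  · rw [← he]
    simp
  · refine mul_le_mul_of_nonneg_left ?_ he.le
    rw [D.layer_dst e]
    linarith [D.minCost_dst_le (w := w) (D.layer (D.src e)) he]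

variable {D} in
theorem IsRootTerminalPath.incidence_mulVec_pathFlow [DecidableEq V] {a : Fin n → Arc}
    (ha : D.IsRootTerminalPath a) : D.incidence *ᵥ pathFlow a = D.supply := by
  obtain ⟨u, h0, hl, hu⟩ := ha
  ext v
  simp only [pathFlow, Matrix.mulVec_sum, Matrix.mulVec_single_one, Finset.sum_apply]
  simp only [Matrix.col_apply, incidence, Matrix.of_apply, (hu _).1, (hu _).2,
    Finset.sum_sub_distrib, supply]
  -- Telescoping: the visits to `v` are counted with the last, then with the first, vertex split
  -- off.
  have h₁ := Fin.sum_univ_castSucc fun i => if u i = v then (1 : ℝ) else 0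
  have h₂ := Fin.sum_univ_succ fun i => if u i = v then (1 : ℝ) else 0
  rw [hl] at h₁
  rw [h0] at h₂
  simp only [eq_comm (a := v)]
  linarith

variable {D} in
theorem IsRootTerminalPath.sum_oneArcs_pathFlow {a : Fin n → Arc}
    (ha : D.IsRootTerminalPath a) (i : Fin n) :
    ∑ e ∈ D.oneArcs i, pathFlow a e = D.pathVector a i := by
  classical
  simp only [pathFlow, Finset.sum_apply]
  rw [Finset.sum_comm]
  rw [Finset.sum_eq_single i]
  · simp [oneArcs, ha.layer_src, pathVector]
  · intro j _ hj
    simp [oneArcs, ha.layer_src, hj]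
  · simp

end Flow

end BDD

/-! ### Polyhedral sets, and sets of binary vectors as their integral points. -/

section Polyhedral

variable {E : Type*} [AddCommGroup E] [Module ℝ E]

/-- A set is polyhedral if it is cut out by finitely many linear inequalities. -/
def IsPolyhedral (F : Set E) : Prop :=
  ∃ C : Finset ((E →ₗ[ℝ] ℝ) × ℝ), F = {w | ∀ r ∈ C, r.1 w ≤ r.2}

theorem isPolyhedral_le (f : E →ₗ[ℝ] ℝ) (c : ℝ) : IsPolyhedral {w | f w ≤ c} :=
  ⟨{(f, c)}, by simp⟩

theorem IsPolyhedral.iInter {ι : Type*} [Finite ι] {F : ι → Set E}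
    (h : ∀ i, IsPolyhedral (F i)) : IsPolyhedral (⋂ i, F i) := by
  classical
  cases nonempty_fintype ι
  choose C hC using h
  refine ⟨Finset.univ.biUnion C, ?_⟩
  ext w
  simp only [hC, Set.mem_iInter, Set.mem_ofPred_eq, Finset.mem_biUnion, Finset.mem_univ, true_and]
  exact ⟨fun h r ⟨i, hr⟩ => h i r hr, fun h i r hr => h r ⟨i, hr⟩⟩

theorem IsPolyhedral.inter {F G : Set E} (hF : IsPolyhedral F) (hG : IsPolyhedral G) :
    IsPolyhedral (F ∩ G) := by
  rw [Set.inter_eq_iInter]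
  exact IsPolyhedral.iInter fun b => by cases b <;> assumption

theorem isPolyhedral_ge (f : E →ₗ[ℝ] ℝ) (c : ℝ) : IsPolyhedral {w | c ≤ f w} := by
  simpa using isPolyhedral_le (-f) (-c)

theorem isPolyhedral_eq (f : E →ₗ[ℝ] ℝ) (c : ℝ) : IsPolyhedral {w | f w = c} := by
  convert (isPolyhedral_le f c).inter (isPolyhedral_ge f c) using 1
  ext w
  exact le_antisymm_iff

theorem isPolyhedral_eq_vec {ι : Type*} [Finite ι] (f : E →ₗ[ℝ] ι → ℝ) (b : ι → ℝ) :
    IsPolyhedral {w | f w = b} := by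
  convert IsPolyhedral.iInter fun i => isPolyhedral_eq (LinearMap.proj i ∘ₗ f) (b i) using 1
  ext w
  simp [funext_iff]

theorem isPolyhedral_ge_vec {ι : Type*} [Finite ι] (f : E →ₗ[ℝ] ι → ℝ) (b : ι → ℝ) :
    IsPolyhedral {w | b ≤ f w} := by
  convert IsPolyhedral.iInter fun i => isPolyhedral_ge (LinearMap.proj i ∘ₗ f) (b i) using 1
  ext w
  simp [Pi.le_def]

theorem isPolyhedral_le_vec {ι : Type*} [Finite ι] (f : E →ₗ[ℝ] ι → ℝ) (b : ι → ℝ) :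
    IsPolyhedral {w | f w ≤ b} := by
  convert IsPolyhedral.iInter fun i => isPolyhedral_le (LinearMap.proj i ∘ₗ f) (b i) using 1
  ext w
  simp [Pi.le_def]

theorem IsPolyhedral.preimage {E' : Type*} [AddCommGroup E'] [Module ℝ E'] {F : Set E}
    (hF : IsPolyhedral F) (f : E' →ₗ[ℝ] E) : IsPolyhedral (f ⁻¹' F) := by
  classical
  obtain ⟨C, rfl⟩ := hF
  refine ⟨C.image fun r => (r.1 ∘ₗ f, r.2), ?_⟩
  ext w
  simp only [Set.mem_preimage, Set.mem_ofPred_eq, Finset.forall_mem_image, LinearMap.comp_apply]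

end Polyhedral

theorem binaryVectors_finite (m : ℕ) : (binaryVectors m).Finite := by
  exact Set.Finite.pi' (t := fun _ => ({0, 1} : Set ℝ)) fun _ => Set.toFinite _

/-- Two 0-1 vectors differ if and only if their Hamming distance is at least one. -/
theorem ne_iff_cut_of_mem_binaryVectors {m : ℕ} {x x₀ : Fin m → ℝ} (hx : x ∈ binaryVectors m)
    (hx₀ : x₀ ∈ binaryVectors m) :
    x ≠ x₀ ↔ (fun j => 2 * x₀ j - 1) ⬝ᵥ x ≤ ∑ j, x₀ j - 1 := by
  have hterm : ∀ j, x₀ j - (2 * x₀ j - 1) * x j = if x j = x₀ j then 0 else 1 := fun j => by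
    rcases hx j with h | h <;> rcases hx₀ j with h₀ | h₀ <;> rw [h, h₀] <;> norm_num
  have hsum : ∑ j, x₀ j - (fun j => 2 * x₀ j - 1) ⬝ᵥ x =
      ∑ j, if x j = x₀ j then (0 : ℝ) else 1 := by
    rw [dotProduct, ← Finset.sum_sub_distrib]
    exact Finset.sum_congr rfl fun j _ => hterm j
  constructor
  · intro hne
    obtain ⟨j, hj⟩ := Function.ne_iff.1 hne
    have := Finset.single_le_sum (f := fun j => if x j = x₀ j then (0 : ℝ) else 1)
      (fun i _ => by split_ifs <;> norm_num) (Finset.mem_univ j)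
    simp only [hj, if_false] at this
    linarith
  · rintro h rfl
    simp only [if_true, Finset.sum_const_zero] at hsum
    linarith

theorem mem_binaryVectors_iff_integral {m : ℕ} {x : Fin m → ℝ} :
    x ∈ binaryVectors m ↔ (∀ j, ∃ q : ℤ, x j = (q : ℝ)) ∧ 0 ≤ x ∧ x ≤ 1 := by
  constructor
  · intro h
    refine ⟨fun j => ?_, fun j => ?_, fun j => ?_⟩
    · rcases h j with h | h
      · exact ⟨0, by simp [h]⟩
      · exact ⟨1, by simp [h]⟩
    · rcases h j with h | h <;> simp [h]
    · rcases h j with h | h <;> simp [h]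
  · rintro ⟨hq, h0, h1⟩ j
    obtain ⟨q, hq⟩ := hq j
    have h0 : (0 : ℝ) ≤ x j := h0 j
    have h1 : x j ≤ (1 : ℝ) := h1 j
    rw [hq] at h0 h1 ⊢
    have h0' : 0 ≤ q := by exact_mod_cast h0
    have h1' : q ≤ 1 := by exact_mod_cast h1
    interval_cases q <;> simp

/-- Every set of 0-1 vectors consists of the integral points of a polyhedron. -/
theorem exists_isPolyhedral_integral_points {m : ℕ} {X : Set (Fin m → ℝ)}
    (hX : X ⊆ binaryVectors m) :
    ∃ Q : Set (Fin m → ℝ), IsPolyhedral Q ∧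
      X = {x : Fin m → ℝ | (∀ j, ∃ q : ℤ, x j = (q : ℝ)) ∧ x ∈ Q} := by
  have : Finite ↥(binaryVectors m \ X) :=
    ((binaryVectors_finite m).subset Set.sdiff_subset).to_subtype
  -- The unit cube, with one Hamming-distance cut for each of the finitely many binary vectors
  -- outside `X`.
  refine ⟨{x | 0 ≤ x} ∩ {x | x ≤ 1} ∩ ⋂ x₀ : ↥(binaryVectors m \ X),
    {x | (fun j => 2 * x₀.1 j - 1) ⬝ᵥ x ≤ ∑ j, x₀.1 j - 1}, ?_, ?_⟩
  · refine ((isPolyhedral_ge_vec LinearMap.id 0).inter (isPolyhedral_le_vec LinearMap.id 1)).inter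
      (IsPolyhedral.iInter fun x₀ => ?_)
    exact isPolyhedral_le (dotProductBilin ℝ ℝ fun j => 2 * x₀.1 j - 1) _
  · ext x
    simp only [Set.mem_inter_iff, Set.mem_iInter, Set.mem_ofPred_eq]
    constructor
    · intro hx
      have hb := mem_binaryVectors_iff_integral.1 (hX hx)
      refine ⟨hb.1, hb.2, fun x₀ => ?_⟩
      refine (ne_iff_cut_of_mem_binaryVectors (hX hx) x₀.2.1).1 ?_
      rintro rfl
      exact x₀.2.2 hx
    · rintro ⟨hq, hb, hc⟩
      have hxb := mem_binaryVectors_iff_integral.2 ⟨hq, hb⟩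
      by_contra hx
      exact (ne_iff_cut_of_mem_binaryVectors hxb hxb).2 (hc ⟨x, hxb, hx⟩) rfl

/-! ### The flow model as a mixed-integer linear program. -/

namespace ARBO

variable {m n p k : ℕ} {V Arc : Type*} [DecidableEq V] [Fintype Arc]

theorem isPolyhedral_linking (P : ARBO m n p k) :
    IsPolyhedral {w : (Fin m → ℝ) × (Fin n → ℝ) | w.2 ∈ P.linkingSet w.1} := by
  let f (q : Fin n × Fin m) : (Fin m → ℝ) × (Fin n → ℝ) →ₗ[ℝ] ℝ :=
    LinearMap.proj (φ := fun _ => ℝ) q.1 ∘ₗ LinearMap.snd ℝ _ _ -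
      LinearMap.proj (φ := fun _ => ℝ) q.2 ∘ₗ LinearMap.fst ℝ _ _
  convert (IsPolyhedral.iInter fun q : P.U₁ => isPolyhedral_le (f q) 0).inter
    ((IsPolyhedral.iInter fun q : P.U₂ => isPolyhedral_eq (f q) 0).inter
      (IsPolyhedral.iInter fun q : P.U₃ => isPolyhedral_ge (f q) 0)) using 1
  ext w
  simp [linkingSet, f, sub_eq_zero]

/-- The network flow model is a mixed-integer linear program. -/
theorem isMILPFeasibleSet_flowFeasible [Finite V] (P : ARBO m n p k)
    (hX : P.X ⊆ binaryVectors m) (D : BDD n V Arc) : IsMILPFeasibleSet (P.flowFeasible D) := by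
  obtain ⟨Q, hQ, hXQ⟩ := exists_isPolyhedral_integral_points hX
  let px : (Fin m → ℝ) × (Fin n → ℝ) × (Arc → ℝ) × (Fin p → ℝ) →ₗ[ℝ] Fin m → ℝ :=
    LinearMap.fst ℝ _ _
  let py : (Fin m → ℝ) × (Fin n → ℝ) × (Arc → ℝ) × (Fin p → ℝ) →ₗ[ℝ] Fin n → ℝ :=
    LinearMap.fst ℝ _ _ ∘ₗ LinearMap.snd ℝ _ _
  let pz : (Fin m → ℝ) × (Fin n → ℝ) × (Arc → ℝ) × (Fin p → ℝ) →ₗ[ℝ] Arc → ℝ :=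
    LinearMap.fst ℝ _ _ ∘ₗ LinearMap.snd ℝ _ _ ∘ₗ LinearMap.snd ℝ _ _
  let pl : (Fin m → ℝ) × (Fin n → ℝ) × (Arc → ℝ) × (Fin p → ℝ) →ₗ[ℝ] Fin p → ℝ :=
    LinearMap.snd ℝ _ _ ∘ₗ LinearMap.snd ℝ _ _ ∘ₗ LinearMap.snd ℝ _ _
  obtain ⟨C, hC⟩ :=
    (isPolyhedral_eq_vec (P.Tᵀ.mulVecLin ∘ₗ pl - py) 0).inter <|
    (isPolyhedral_eq_vec
      (py - LinearMap.pi fun i => ∑ a ∈ D.oneArcs i, LinearMap.proj a ∘ₗ pz) 0).inter <|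
    (isPolyhedral_eq_vec (D.incidence.mulVecLin ∘ₗ pz) D.supply).inter <|
    (P.isPolyhedral_linking.preimage (px.prod py)).inter <|
    (hQ.preimage px).inter <|
    (isPolyhedral_ge_vec pz 0).inter (isPolyhedral_ge_vec pl 0)
  refine ⟨C, ?_⟩
  ext ⟨x, y, z, lam⟩
  have hC' := Set.ext_iff.1 hC (x, y, z, lam)
  rw [Set.mem_ofPred_eq] at hC' ⊢
  rw [← hC']
  simp only [flowFeasible, Set.mem_ofPred_eq, Set.mem_inter_iff, Set.mem_preimage, hXQ, px, py, pz,
    pl, LinearMap.sub_apply, sub_eq_zero, LinearMap.comp_apply, Matrix.mulVecLin_apply,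
    LinearMap.fst_apply, LinearMap.snd_apply, LinearMap.prod_apply, funext_iff (f := y),
    LinearMap.pi_apply, LinearMap.sum_apply, LinearMap.proj_apply]
  tauto

end ARBO

/-! ### Weak and strong duality between the two problems. -/

namespace ARBO

variable {m n p k : ℕ} {V Arc : Type*} [DecidableEq V] [Fintype Arc]

theorem recourseSet_inter_finite (P : ARBO m n p k) (x : Fin m → ℝ) :
    (P.recourseSet ∩ P.linkingSet x).Finite :=
  (binaryVectors_finite n).subset fun _ hy => hy.1.1

/-- The linking constraints satisfied by a unit flow are satisfied by all paths in its support. -/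
theorem pathVector_mem_linkingSet [Fintype V] (P : ARBO m n p k) (D : BDD n V Arc)
    {x : Fin m → ℝ} (hx : x ∈ binaryVectors m) {y : Fin n → ℝ} {z : Arc → ℝ}
    (hyz : ∀ i, y i = ∑ a ∈ D.oneArcs i, z a) (hz : D.incidence *ᵥ z = D.supply) (h0 : 0 ≤ z)
    (hy : y ∈ P.linkingSet x) {a : Fin n → Arc} (ha : D.IsRootTerminalPath a)
    (hpos : ∀ i, 0 < z (a i)) : D.pathVector a ∈ P.linkingSet x := by
  have hyz' : ∀ i, y i = ∑ e, if D.layer (D.src e) = i.castSucc ∧ D.label e = true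
      then z e else 0 := fun i => by
    rw [hyz i, BDD.oneArcs, Finset.sum_filter]
  have hone : ∀ i, D.label (a i) = true → 0 < y i := fun i hi => by
    rw [hyz' i]
    refine Finset.sum_pos' (fun e _ => ?_) ⟨a i, Finset.mem_univ _, ?_⟩
    · split_ifs
      exacts [h0 e, le_rfl]
    · rw [if_pos ⟨ha.layer_src i, hi⟩]
      exact hpos i
  -- Layer `i` carries one unit in total, and the 0-arc `a i` takes a positive share of it.
  have hzero : ∀ i, D.label (a i) ≠ true → y i < 1 := fun i hi => by
    rw [hyz' i, ← D.sum_layer_eq_one hz i]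
    refine Finset.sum_lt_sum (fun e _ => ?_) ⟨a i, Finset.mem_univ _, ?_⟩
    · have := h0 e
      simp only [Pi.zero_apply] at this
      split_ifs <;> first | exact le_rfl | exact this | tauto
    · rw [if_neg fun h => hi h.2, if_pos (ha.layer_src i)]
      exact hpos i
  have hle : ∀ i j, y i ≤ x j → D.pathVector a i ≤ x j := fun i j h => by
    unfold BDD.pathVector
    split_ifs with hl
    · rcases hx j with hj | hj
      · linarith [hone i hl]
      · exact hj.ge
    · rcases hx j with hj | hj <;> simp [hj]
  have hge : ∀ i j, x j ≤ y i → x j ≤ D.pathVector a i := fun i j h => by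
    unfold BDD.pathVector
    split_ifs with hl
    · rcases hx j with hj | hj <;> simp [hj]
    · rcases hx j with hj | hj
      · exact hj.le
      · linarith [hzero i hl]
  exact ⟨fun q hq => hle _ _ (hy.1 q hq),
    fun q hq => le_antisymm (hle _ _ (hy.2.1 q hq).le) (hge _ _ (hy.2.1 q hq).ge),
    fun q hq => hge _ _ (hy.2.2 q hq)⟩

/-- A feasible flow can be rounded to a recourse decision without increasing a given cost. -/
theorem exists_recourse_cost_le [Fintype V] (P : ARBO m n p k) (hX : P.X ⊆ binaryVectors m)
    (D : BDD n V Arc) (hD : D.IsExactFor P.recourseSet) {x : Fin m → ℝ} {y : Fin n → ℝ}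
    {z : Arc → ℝ} {lam : Fin p → ℝ} (hw : (x, y, z, lam) ∈ P.flowFeasible D) (ξ : Fin n → ℝ) :
    ∃ y' ∈ P.recourseSet ∩ P.linkingSet x, ξ ⬝ᵥ y' ≤ ξ ⬝ᵥ y := by
  obtain ⟨-, hyz, hz, hy, hx, h0, -⟩ := hw
  -- A 1-arc leaving layer `i` costs `ξ i` and a 0-arc nothing, so the flow costs `ξᵀ y` and a path
  -- costs `ξᵀ` times its label vector.
  obtain ⟨a, ha, hpos, hcost⟩ := D.exists_path_cost_le h0 hz fun e =>
    if D.label e then ξ ⟨D.layer (D.src e), D.layer_src_lt e⟩ else 0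
  refine ⟨D.pathVector a, ⟨?_, P.pathVector_mem_linkingSet D (hX hx) hyz hz h0 hy ha hpos⟩, ?_⟩
  · have h : D.pathVector a ∈ {y | ∃ a, D.IsRootTerminalPath a ∧ D.pathVector a = y} :=
      ⟨a, ha, rfl⟩
    rwa [← show P.recourseSet = _ from hD] at h
  · convert hcost using 1
    · refine Finset.sum_congr rfl fun i _ => ?_
      simp [BDD.pathVector, ha.layer_src]
    · simp only [dotProduct, hyz, BDD.oneArcs, Finset.sum_filter, Finset.mul_sum]
      rw [Finset.sum_comm]
      refine Finset.sum_congr rfl fun e _ => ?_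
      rw [Finset.sum_eq_single ⟨D.layer (D.src e), D.layer_src_lt e⟩]
      · simp [mul_comm]
      · intro i _ hi
        have : D.layer (D.src e) ≠ i.castSucc := fun h => hi (Fin.ext (by simp [h]))
        simp [this]
      · simp

/-- Weak duality: a feasible flow bounds the worst-case cost. -/
theorem worstCaseCost_le_flowObjective [Fintype V] (P : ARBO m n p k)
    (hX : P.X ⊆ binaryVectors m) (D : BDD n V Arc) (hD : D.IsExactFor P.recourseSet)
    {w : (Fin m → ℝ) × (Fin n → ℝ) × (Arc → ℝ) × (Fin p → ℝ)} (hw : w ∈ P.flowFeasible D) :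
    P.worstCaseCost w.1 ≤ (P.flowObjective w : EReal) := by
  obtain ⟨x, y, z, lam⟩ := w
  refine iSup₂_le fun ξ hξ => ?_
  obtain ⟨y', hy', hle⟩ := P.exists_recourse_cost_le hX D hD hw ξ
  refine (iInf₂_le y' hy').trans (EReal.coe_le_coe_iff.2 ?_)
  obtain ⟨rfl, -, -, -, -, -, hlam⟩ := hw
  have h : ξ ⬝ᵥ P.Tᵀ *ᵥ lam ≤ P.d ⬝ᵥ lam := by
    rw [Matrix.dotProduct_mulVec, Matrix.vecMul_transpose]
    exact dotProduct_le_dotProduct_of_nonneg_right hξ hlam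
  simp only [flowObjective]
  linarith

theorem linkingSet_convex (P : ARBO m n p k) (x : Fin m → ℝ) : Convex ℝ (P.linkingSet x) := by
  intro y hy y' hy' s t hs ht hst
  refine ⟨fun q hq => ?_, fun q hq => ?_, fun q hq => ?_⟩
  · have h₁ := mul_le_mul_of_nonneg_left (hy.1 q hq) hs
    have h₂ := mul_le_mul_of_nonneg_left (hy'.1 q hq) ht
    calc _ ≤ s * x q.2 + t * x q.2 := add_le_add h₁ h₂
      _ = x q.2 := by rw [← add_mul, hst, one_mul]
  · simp only [Pi.add_apply, Pi.smul_apply, smul_eq_mul, hy.2.1 q hq, hy'.2.1 q hq]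
    rw [← add_mul, hst, one_mul]
  · have h₁ := mul_le_mul_of_nonneg_left (hy.2.2 q hq) hs
    have h₂ := mul_le_mul_of_nonneg_left (hy'.2.2 q hq) ht
    calc x q.2 = s * x q.2 + t * x q.2 := by rw [← add_mul, hst, one_mul]
      _ ≤ _ := add_le_add h₁ h₂

/-- Strong duality: every real upper bound on the worst-case cost is met by a feasible flow. -/
theorem exists_flowObjective_le (P : ARBO m n p k) (hΞ : P.uncertaintySet.Nonempty)
    (D : BDD n V Arc) (hD : D.IsExactFor P.recourseSet) {x : Fin m → ℝ} (hx : x ∈ P.X)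
    (hne : (P.recourseSet ∩ P.linkingSet x).Nonempty) {v : ℝ} (hv : P.worstCaseCost x ≤ v) :
    ∃ w ∈ P.flowFeasible D, w.1 = x ∧ P.flowObjective w ≤ v := by
  have hfin := P.recourseSet_inter_finite x
  set S := hfin.toFinset with hSdef
  have hS : ∀ y, y ∈ S ↔ y ∈ P.recourseSet ∩ P.linkingSet x := fun y => by simp [hSdef]
  have hSne : S.Nonempty := by simpa [hSdef] using hne
  obtain ⟨lam, μ, hlam, hμ, hμ1, hT, hd⟩ :=
    exists_dual_certificate P.T P.d hΞ S hSne (v - P.c ⬝ᵥ x) fun ξ hξ => by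
      obtain ⟨y, hy, hmin⟩ := S.exists_min_image (fun y => ξ ⬝ᵥ y) hSne
      refine ⟨y, hy, ?_⟩
      have h₁ : ((P.c ⬝ᵥ x + ξ ⬝ᵥ y : ℝ) : EReal) ≤ P.worstCaseCost x :=
        le_trans (le_iInf₂ fun y' hy' => EReal.coe_le_coe_iff.2
            (add_le_add_right (hmin y' ((hS y').2 hy')) _))
          (le_iSup₂ (f := fun ξ (_ : ξ ∈ P.uncertaintySet) =>
            ⨅ y ∈ P.recourseSet ∩ P.linkingSet x, ((P.c ⬝ᵥ x + ξ ⬝ᵥ y : ℝ) : EReal)) ξ hξ)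
      have := EReal.coe_le_coe_iff.1 (h₁.trans hv)
      linarith
  have hpath : ∀ y : S, ∃ a, D.IsRootTerminalPath a ∧ D.pathVector a = y := fun y => by
    have h := ((hS y).1 y.2).1
    rwa [show P.recourseSet = _ from hD] at h
  choose a ha hay using hpath
  have hμ1' : ∑ y : S, μ y = 1 := by rw [← hμ1, Finset.sum_coe_sort S μ]
  refine ⟨(x, ∑ y : S, μ y • (y : Fin n → ℝ), ∑ y : S, μ y • BDD.pathFlow (a y), lam),
    ⟨?_, fun i => ?_, ?_, ?_, hx, ?_, hlam⟩, rfl, ?_⟩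
  · rw [hT, Finset.sum_coe_sort S fun y => μ y • y]
  · simp only [Finset.sum_apply, Pi.smul_apply, smul_eq_mul]
    rw [Finset.sum_comm]
    refine Finset.sum_congr rfl fun y _ => ?_
    rw [← Finset.mul_sum, (ha y).sum_oneArcs_pathFlow, hay]
  · rw [Matrix.mulVec_sum]
    simp only [Matrix.mulVec_smul, (ha _).incidence_mulVec_pathFlow]
    rw [← Finset.sum_smul, hμ1', one_smul]
  · exact (P.linkingSet_convex x).sum_mem (fun y _ => hμ y) hμ1' fun y _ => ((hS y).1 y.2).2
  · exact Finset.sum_nonneg fun y _ => smul_nonneg (hμ y) (BDD.pathFlow_nonneg _)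
  · simp only [flowObjective]
    linarith

/-- The inner infimum is over the empty set. Nonemptiness of `Ξ` matters: a supremum over an empty
`Ξ` would be `⊥`. -/
theorem worstCaseCost_eq_top (P : ARBO m n p k) (hΞ : P.uncertaintySet.Nonempty)
    {x : Fin m → ℝ} (hx : ¬(P.recourseSet ∩ P.linkingSet x).Nonempty) :
    P.worstCaseCost x = ⊤ := by
  obtain ⟨ξ, hξ⟩ := hΞ
  rw [Set.not_nonempty_iff_eq_empty] at hx
  rw [worstCaseCost, hx, eq_top_iff]
  exact le_iSup₂_of_le ξ hξ (by simp)

/-- The worst-case cost of a first-stage decision that admits a recourse decision is finite. -/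
theorem exists_worstCaseCost_eq_coe (P : ARBO m n p k) (hΞ : P.uncertaintySet.Nonempty)
    (hΞb : Bornology.IsBounded P.uncertaintySet) {x : Fin m → ℝ}
    (hx : (P.recourseSet ∩ P.linkingSet x).Nonempty) :
    ∃ v : ℝ, P.worstCaseCost x = v := by
  have htop : P.worstCaseCost x ≠ ⊤ := by
    obtain ⟨y, hy⟩ := hx
    obtain ⟨R, hR⟩ := hΞb.exists_norm_le
    refine ne_top_of_le_ne_top (EReal.coe_ne_top (P.c ⬝ᵥ x + ∑ _i : Fin n, R)) ?_
    refine iSup₂_le fun ξ hξ => (iInf₂_le y hy).trans (EReal.coe_le_coe_iff.2 ?_)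
    refine add_le_add_right (Finset.sum_le_sum fun i _ => ?_) _
    have h₁ : |ξ i| ≤ R := (norm_le_pi_norm ξ i).trans (hR ξ hξ)
    have h₂ := le_abs_self (ξ i)
    have h₃ := abs_nonneg (ξ i)
    rcases hy.1.1 i with h | h <;> rw [h] <;> linarith
  have hbot : P.worstCaseCost x ≠ ⊥ := by
    obtain ⟨ξ, hξ⟩ := hΞ
    obtain ⟨y, -, hmin⟩ := Set.exists_min_image _ (fun y => ξ ⬝ᵥ y)
      (P.recourseSet_inter_finite x) hx
    refine ne_bot_of_le_ne_bot (EReal.coe_ne_bot (P.c ⬝ᵥ x + ξ ⬝ᵥ y))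
      (le_iSup₂_of_le ξ hξ (le_iInf₂ fun y' hy' => EReal.coe_le_coe_iff.2 ?_))
    exact add_le_add_right (hmin y' hy') _
  exact ⟨_, (EReal.coe_toReal htop hbot).symm⟩

theorem worstCaseCost_eq_iInf [Fintype V] (P : ARBO m n p k) (hX : P.X ⊆ binaryVectors m)
    (hΞ : P.uncertaintySet.Nonempty) (hΞb : Bornology.IsBounded P.uncertaintySet)
    (D : BDD n V Arc) (hD : D.IsExactFor P.recourseSet) {x : Fin m → ℝ} (hx : x ∈ P.X) :
    P.worstCaseCost x = ⨅ w ∈ {w ∈ P.flowFeasible D | w.1 = x}, (P.flowObjective w : EReal) := by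
  refine le_antisymm (le_iInf₂ fun w hw => ?_) ?_
  · rw [← hw.2]
    exact P.worstCaseCost_le_flowObjective hX D hD hw.1
  · by_cases hne : (P.recourseSet ∩ P.linkingSet x).Nonempty
    · obtain ⟨v, hv⟩ := P.exists_worstCaseCost_eq_coe hΞ hΞb hne
      obtain ⟨w, hw, hwx, hle⟩ := P.exists_flowObjective_le hΞ D hD hx hne hv.le
      rw [hv]
      exact iInf₂_le_of_le w ⟨hw, hwx⟩ (EReal.coe_le_coe_iff.2 hle)
    · rw [P.worstCaseCost_eq_top hΞ hne]
      exact le_top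

end ARBO

/-! ### The equivalence. -/

theorem mainTheorem1 {m n p k : ℕ} {V Arc : Type*} [Fintype V] [DecidableEq V] [Fintype Arc]
    (P : ARBO m n p k)
    (hX : P.X ⊆ binaryVectors m)
    (hΞ : P.uncertaintySet.Nonempty)
    (hΞb : Bornology.IsBounded P.uncertaintySet)
    (D : BDD n V Arc) (hD : D.IsExactFor P.recourseSet) :
    -- the network flow model is a mixed-integer linear program, with only `x` integer
    IsMILPFeasibleSet (P.flowFeasible D) ∧
    -- the two problems have the same optimal value
    P.optimalValue = (⨅ w ∈ P.flowFeasible D, (P.flowObjective w : EReal)) ∧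
    -- they agree for every fixed first-stage decision
    (∀ x ∈ P.X, P.worstCaseCost x =
      ⨅ w ∈ {w ∈ P.flowFeasible D | w.1 = x}, (P.flowObjective w : EReal)) ∧
    -- they have the same optimal first-stage decisions
    (∀ x, P.IsOptimalFirstStage x ↔
      ∃ w ∈ P.flowFeasible D, w.1 = x ∧
        ∀ w' ∈ P.flowFeasible D, P.flowObjective w ≤ P.flowObjective w') := by
  have hfix := fun x (hx : x ∈ P.X) => P.worstCaseCost_eq_iInf hX hΞ hΞb D hD hx
  have hmem : ∀ w ∈ P.flowFeasible D, w.1 ∈ P.X := fun w hw => hw.2.2.2.2.1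
  refine ⟨P.isMILPFeasibleSet_flowFeasible hX D, le_antisymm ?_ ?_, hfix, fun x => ⟨?_, ?_⟩⟩
  · exact le_iInf₂ fun w hw => (iInf₂_le w.1 (hmem w hw)).trans
      (P.worstCaseCost_le_flowObjective hX D hD hw)
  · refine le_iInf₂ fun x hx => ?_
    rw [hfix x hx]
    exact le_iInf₂ fun w hw => iInf₂_le w hw.1
  · rintro ⟨hx, hne, hmin⟩
    obtain ⟨v, hv⟩ := P.exists_worstCaseCost_eq_coe hΞ hΞb hne
    obtain ⟨w, hw, hwx, hle⟩ := P.exists_flowObjective_le hΞ D hD hx hne hv.le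
    refine ⟨w, hw, hwx, fun w' hw' => hle.trans (EReal.coe_le_coe_iff.1 ?_)⟩
    rw [← hv]
    exact (hmin _ (hmem w' hw')).trans (P.worstCaseCost_le_flowObjective hX D hD hw')
  · rintro ⟨w, hw, rfl, hmin⟩
    refine ⟨hmem w hw, ?_, fun x' hx' => ?_⟩
    -- Rounding with zero cost: only the existence of a recourse decision is needed.
    · obtain ⟨y, hy, -⟩ := P.exists_recourse_cost_le hX D hD hw 0
      exact ⟨y, hy⟩
    · refine (P.worstCaseCost_le_flowObjective hX D hD hw).trans ?_
      rw [hfix x' hx']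
      exact le_iInf₂ fun w' hw' => EReal.coe_le_coe_iff.2 (hmin w' hw'.1)
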